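/- Let $f\ge 0$ be a probability density on $\mathbb R$ that vanishes outside $[0,1]$. There are $k$ agents; agent $i$ chooses a location $x_i\in[\frac14,\frac34]$ and covers $R_i=[x_i-\frac14,x_i+\frac14]$ (common width $\frac12$). Let $c(y,\vec x)$ be the number of agents $i$ with $y\in R_i$; the support of agent $i$ is $s_i(\vec x)=\int_{R_i} f(y)/c(y,\vec x)\,dy$. In the winner-utility game, the agents of largest support (the winners) share a total utility of $1$ equally and all other agents have utility $0$. Algorithm 2 is the following procedure. Let $u_1=\max_{z\in[1/4,3/4]}\int_{z-1/4}^{z+1/4}f(y)\,dy$. 1. If two agents can be placed simultaneously so that each of them has support $u_1$, put $\lceil k/2\rceil$ agents at $\frac14$ and the other $k-\lceil k/2\rceil$ agents at $\frac34$. 2. Otherwise, choose any $x_1\in[\frac14,\frac34]$ with $\int_{x_1-1/4}^{x_1+1/4}f(y)\,dy=u_1$. Let $t\in\{1,2,\dots\}\cup\{\infty\}$ be such that each of the first $t$ agents maximizes its support by locating at $x_1$ when all the previous agents are at $x_1$, but the $(t+1)$-th agent does not ($t=\infty$ if every agent does). (a) If $k\le t+1$, put all the agents at $x_1$. (b) If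 $k\ge t+2$, for $x,z\in[\frac14,\frac34]$ let $g_x(z)=\int_{z-1/4}^{z+1/4}\frac{f(y)}{c_x(y)+1}\,dy$, where $c_x(y)=k-2$ if $|y-x|\le\frac14$ and $c_x(y)=0$ otherwise, and let $ll(x)=\max_{z\in[1/4,\,x]}g_x(z)$ and $rl(x)=\max_{z\in[x,\,3/4]}g_x(z)$. Choose any $x^*\in[\frac14,\frac34]$ with $ll(x^*)=rl(x^*)$, any $x_l\in[\frac14,x^*]$ with $g_{x^*}(x_l)=ll(x^*)$, and any $x_r\in[x^*,\frac34]$ with $g_{x^*}(x_r)=rl(x^*)$. Put the first $k-2$ agents at $x^*$, the $(k-1)$-th at $x_l$ and the $k$-th at $x_r$. Theorem. For every such $f$ and every number $k$ of agents, Algorithm 2 can always be carried out: a location $x_1$ as in step 2 exists; in case (b), for every choice of $x_1$ a point $x^*$ exists, and for every such $x^*$ points $x_l$ and $x_r$ exist. The condition in step 1 holds if and only if $\int_0^{1/2}f(y)\,dy=\int_{1/2}^1f(y)\,dy=u_1$. Whatever choices are made, the resulting location profile is a pure Nash equilibrium of the winner-utility game: no agent can strictly increase its utility by moving alone to another location in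 $[\frac14,\frac34]$. -/

import Mathlib

open Set MeasureTheory

noncomputable section

namespace AttractionGame

/-- A density of clients on the location space `[0, 1]`. -/
structure IsClientDensity (f : ℝ → ℝ) : Prop where
  nonneg : ∀ y, 0 ≤ f y
  eq_zero_outside : ∀ y, y ∉ Icc (0 : ℝ) 1 → f y = 0
  integrable : Integrable f
  integral_eq_one : ∫ y, f y = 1

/-! ### Attraction games with agents `Fin n`, widths `w` and location profiles `x` -/

/-- The attraction interval of an agent of width `w` located at `x`. -/
def attractionInterval (w x : ℝ) : Set ℝ := Icc (x - w / 2) (x + w / 2)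

/-- The admissible locations of an agent of width `w`. -/
def locations (w : ℝ) : Set ℝ := Icc (w / 2) (1 - w / 2)

open Classical in
/-- The number of agents whose attraction interval covers `y`. -/
def congestion {n : ℕ} (w x : Fin n → ℝ) (y : ℝ) : ℕ :=
  (Finset.univ.filter fun i => y ∈ attractionInterval (w i) (x i)).card

/-- The support of agent `i`: every client is shared equally by the agents that cover it. -/
def support (f : ℝ → ℝ) {n : ℕ} (w x : Fin n → ℝ) (i : Fin n) : ℝ :=
  ∫ y in (x i - w i / 2)..(x i + w i / 2), f y / (congestion w x y : ℝ)

open Classical in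
/-- The winners: the agents of largest support. -/
def winners (f : ℝ → ℝ) {n : ℕ} (w x : Fin n → ℝ) : Finset (Fin n) :=
  Finset.univ.filter fun i => ∀ j, support f w x j ≤ support f w x i

open Classical in
/-- The winner utility: the winners share a total utility of one equally. -/
def winnerUtility (f : ℝ → ℝ) {n : ℕ} (w x : Fin n → ℝ) (i : Fin n) : ℝ :=
  if i ∈ winners f w x then 1 / ((winners f w x).card : ℝ) else 0

/-- Pure Nash equilibria of the game with strategy sets `L` and utilities `u`. -/
def IsNashEquilibrium {n : ℕ} (L : Fin n → Set ℝ) (u : (Fin n → ℝ) → Fin n → ℝ)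
    (x : Fin n → ℝ) : Prop :=
  (∀ i, x i ∈ L i) ∧ ∀ i, ∀ x' ∈ L i, u (Function.update x i x') i ≤ u x i

/-- Pure Nash equilibria of the attraction game with widths `w`, in the winner utility setting. -/
def IsWinnerNashEquilibrium (f : ℝ → ℝ) {n : ℕ} (w x : Fin n → ℝ) : Prop :=
  IsNashEquilibrium (fun i => locations (w i)) (winnerUtility f w) x

/-! ### The construction for common width `1 / 2` -/

/-- `n` agents of width `1 / 2`. -/
def halfWidths (n : ℕ) : Fin n → ℝ := fun _ => 1 / 2

/-- The support that one further agent of width `1 / 2` obtains at `z` when `m` agents of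
width `1 / 2` are already placed at `x`. -/
def newcomerSupport (f : ℝ → ℝ) {m : ℕ} (x : Fin m → ℝ) (z : ℝ) : ℝ :=
  ∫ y in (z - 1 / 4)..(z + 1 / 4), f y / ((congestion (halfWidths m) x y : ℝ) + 1)

/-- The largest support `u₁` that a single agent can obtain. -/
def maxSupport (f : ℝ → ℝ) : ℝ :=
  sSup ((fun z => ∫ y in (z - 1 / 4)..(z + 1 / 4), f y) '' locations (1 / 2))

/-- Two agents can be placed simultaneously so that both obtain support `u₁`. -/
def TwoAgentsAchieveMax (f : ℝ → ℝ) : Prop :=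
  ∃ x : Fin 2 → ℝ, (∀ i, x i ∈ locations (1 / 2)) ∧
    ∀ i, support f (halfWidths 2) x i = maxSupport f

/-- `x₁` is a location at which a single agent obtains support `u₁`. -/
def IsFirstLocation (f : ℝ → ℝ) (x₁ : ℝ) : Prop :=
  x₁ ∈ locations (1 / 2) ∧ ∫ y in (x₁ - 1 / 4)..(x₁ + 1 / 4), f y = maxSupport f

/-- When `j` agents are already at `x₁`, the next agent maximizes its support at `x₁`. -/
def NextMaximizesAt (f : ℝ → ℝ) (x₁ : ℝ) (j : ℕ) : Prop :=
  ∀ z ∈ locations (1 / 2),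
    newcomerSupport f (fun _ : Fin j => x₁) z ≤ newcomerSupport f (fun _ : Fin j => x₁) x₁

/-- The number `t` such that each of the first `t` agents, but not the next one, maximizes its
support at `x₁` when all the previous agents are at `x₁`; `⊤` if every agent does so. -/
def stackSize (f : ℝ → ℝ) (x₁ : ℝ) : ℕ∞ :=
  sSup {t : ℕ∞ | ∀ j : ℕ, (j : ℕ∞) < t → NextMaximizesAt f x₁ j}

/-- The largest support of a newcomer weakly to the left of `x` when `m` agents are at `x`. -/
def ll (f : ℝ → ℝ) (m : ℕ) (x : ℝ) : ℝ :=
  sSup (newcomerSupport f (fun _ : Fin m => x) '' {z ∈ locations (1 / 2) | z ≤ x})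

/-- The largest support of a newcomer weakly to the right of `x` when `m` agents are at `x`. -/
def rl (f : ℝ → ℝ) (m : ℕ) (x : ℝ) : ℝ :=
  sSup (newcomerSupport f (fun _ : Fin m => x) '' {z ∈ locations (1 / 2) | x ≤ z})

/-- The left and the right largest support agree at `x`. -/
def IsBalancePoint (f : ℝ → ℝ) (m : ℕ) (x : ℝ) : Prop :=
  x ∈ locations (1 / 2) ∧ ll f m x = rl f m x

/-- `z ≤ x` attains the left largest support. -/
def IsLeftSolution (f : ℝ → ℝ) (m : ℕ) (x z : ℝ) : Prop :=
  z ∈ locations (1 / 2) ∧ z ≤ x ∧ newcomerSupport f (fun _ : Fin m => x) z = ll f m x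

/-- `z ≥ x` attains the right largest support. -/
def IsRightSolution (f : ℝ → ℝ) (m : ℕ) (x z : ℝ) : Prop :=
  z ∈ locations (1 / 2) ∧ x ≤ z ∧ newcomerSupport f (fun _ : Fin m => x) z = rl f m x

/-- The first `⌈k / 2⌉` agents at `1 / 4`, the others at `3 / 4`. -/
def splitProfile (k : ℕ) : Fin k → ℝ :=
  fun i => if (i : ℕ) < (k + 1) / 2 then 1 / 4 else 3 / 4

/-- The first `k - 2` agents at `x`, the last but one at `xl`, the last one at `xr`. -/
def balancedProfile (k : ℕ) (x xl xr : ℝ) : Fin k → ℝ :=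
  fun i => if (i : ℕ) + 2 < k then x else if (i : ℕ) + 2 = k then xl else xr

/-- `Algorithm2 f k p`: for the density `f` and `k` agents, `p` is an output of the algorithm,
for some choice at each step where it picks one of several locations. -/
inductive Algorithm2 (f : ℝ → ℝ) (k : ℕ) : (Fin k → ℝ) → Prop
  | split (h : TwoAgentsAchieveMax f) : Algorithm2 f k (splitProfile k)
  | stack (x₁ : ℝ) (h : ¬ TwoAgentsAchieveMax f) (h₁ : IsFirstLocation f x₁)
      (ht : (k : ℕ∞) ≤ stackSize f x₁ + 1) : Algorithm2 f k (fun _ => x₁)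
  | balance (x₁ xs xl xr : ℝ) (h : ¬ TwoAgentsAchieveMax f) (h₁ : IsFirstLocation f x₁)
      (ht : stackSize f x₁ + 2 ≤ (k : ℕ∞)) (hs : IsBalancePoint f (k - 2) xs)
      (hl : IsLeftSolution f (k - 2) xs xl) (hr : IsRightSolution f (k - 2) xs xr) :
      Algorithm2 f k (balancedProfile k xs xl xr)

end AttractionGame

end

namespace AttractionGame

variable {f : ℝ → ℝ}

/-- The mass of the clients in `[0, y]`. -/
noncomputable def mass (f : ℝ → ℝ) (y : ℝ) : ℝ := ∫ t in (0 : ℝ)..y, f t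

theorem integral_eq_mass_sub (hf : IsClientDensity f) (a b : ℝ) :
    ∫ y in a..b, f y = mass f b - mass f a :=
  (intervalIntegral.integral_interval_sub_left hf.integrable.intervalIntegrable
    hf.integrable.intervalIntegrable).symm

theorem mass_mono (hf : IsClientDensity f) : Monotone (mass f) := by
  intro a b hab
  have := intervalIntegral.integral_nonneg (μ := volume) hab fun y _ => hf.nonneg y
  rw [integral_eq_mass_sub hf] at this
  linarith

theorem continuous_mass (hf : IsClientDensity f) : Continuous (mass f) :=
  intervalIntegral.continuous_primitive (fun _ _ => hf.integrable.intervalIntegrable) 0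

theorem mass_zero : mass f 0 = 0 := by simp [mass]

theorem mass_one (hf : IsClientDensity f) : mass f 1 = 1 := by
  rw [mass, intervalIntegral.integral_of_le zero_le_one, ← integral_Icc_eq_integral_Ioc]
  refine Eq.trans ?_ hf.integral_eq_one
  exact setIntegral_eq_integral_of_forall_compl_eq_zero fun y hy => hf.eq_zero_outside y hy

theorem mem_locations_half {z : ℝ} : z ∈ locations (1 / 2) ↔ 1 / 4 ≤ z ∧ z ≤ 3 / 4 := by
  norm_num [locations]

theorem mem_attractionInterval_half {k : ℕ} {i : Fin k} {x y : ℝ} :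
    y ∈ attractionInterval (halfWidths k i) x ↔ x - 1 / 4 ≤ y ∧ y ≤ x + 1 / 4 := by
  norm_num [attractionInterval, halfWidths]

open Classical in
theorem measurable_congestion {k : ℕ} (w x : Fin k → ℝ) : Measurable (congestion w x) := by
  have : congestion w x = fun y => ∑ i, if y ∈ attractionInterval (w i) (x i) then 1 else 0 := by
    funext y
    simp [congestion]
  rw [this]
  exact Finset.measurable_fun_sum _ fun i _ =>
    Measurable.ite measurableSet_Icc measurable_const measurable_const

theorem integrable_div_natCast (hf : IsClientDensity f) {c : ℝ → ℕ} (hc : Measurable c) :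
    Integrable fun y => f y / (c y : ℝ) := by
  have hm : Measurable fun y => (c y : ℝ) := measurable_from_top.comp hc
  refine hf.integrable.mono'
    (hf.integrable.aestronglyMeasurable.aemeasurable.div hm.aemeasurable).aestronglyMeasurable
    (Filter.Eventually.of_forall fun y => ?_)
  have h0 := hf.nonneg y
  rw [Real.norm_of_nonneg (by positivity)]
  rcases Nat.eq_zero_or_pos (c y) with h | h
  · simpa [h] using h0
  · exact div_le_self h0 (by exact_mod_cast h)

theorem integrable_share (hf : IsClientDensity f) {k : ℕ} (w x : Fin k → ℝ) :
    Integrable fun y => f y / (congestion w x y : ℝ) :=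
  integrable_div_natCast hf (measurable_congestion w x)

theorem integrable_newcomer_share (hf : IsClientDensity f) {k : ℕ} (w x : Fin k → ℝ) :
    Integrable fun y => f y / ((congestion w x y : ℝ) + 1) := by
  have := integrable_div_natCast hf ((measurable_congestion w x).add_const 1)
  simpa using this

theorem support_halfWidths {k : ℕ} (x : Fin k → ℝ) (i : Fin k) :
    support f (halfWidths k) x i =
      ∫ y in (x i - 1 / 4)..(x i + 1 / 4), f y / (congestion (halfWidths k) x y : ℝ) := by
  norm_num [support, halfWidths]

/-- If only agents of `T` cover points of `(a, b)`, and agent `i` covers them all, then the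
agents take at least the share `1 / |T|` there. -/
theorem le_integral_share (hf : IsClientDensity f) {k : ℕ} (x : Fin k → ℝ) {a b : ℝ} (hab : a ≤ b)
    (T : Finset (Fin k)) (i : Fin k)
    (hi : ∀ y, a < y → y < b → x i - 1 / 4 ≤ y ∧ y ≤ x i + 1 / 4)
    (hT : ∀ y, a < y → y < b → ∀ j, j ∉ T → ¬ (x j - 1 / 4 ≤ y ∧ y ≤ x j + 1 / 4)) :
    (mass f b - mass f a) / (T.card : ℝ) ≤
      ∫ y in a..b, f y / (congestion (halfWidths k) x y : ℝ) := by
  classical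
  rw [← integral_eq_mass_sub hf, ← intervalIntegral.integral_div]
  refine intervalIntegral.integral_mono_on_of_le_Ioo hab
    (hf.integrable.div_const _).intervalIntegrable (integrable_share hf _ _).intervalIntegrable ?_
  rintro y ⟨hay, hyb⟩
  have h1 : 0 < congestion (halfWidths k) x y :=
    Finset.card_pos.2 ⟨i, by simpa [mem_attractionInterval_half] using hi y hay hyb⟩
  have h2 : congestion (halfWidths k) x y ≤ T.card := by
    refine Finset.card_le_card fun j hj => ?_
    by_contra h
    exact hT y hay hyb j h (mem_attractionInterval_half.1 (Finset.mem_filter.1 hj).2)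
  exact div_le_div_of_nonneg_left (hf.nonneg y) (by exact_mod_cast h1) (by exact_mod_cast h2)

/-- If all agents of `T` cover `(a, b)`, then each agent takes at most the share `1 / |T|`. -/
theorem integral_share_le (hf : IsClientDensity f) {k : ℕ} (x : Fin k → ℝ) {a b : ℝ} (hab : a ≤ b)
    (T : Finset (Fin k)) (hT0 : T.Nonempty)
    (hT : ∀ y, a < y → y < b → ∀ j ∈ T, x j - 1 / 4 ≤ y ∧ y ≤ x j + 1 / 4) :
    ∫ y in a..b, f y / (congestion (halfWidths k) x y : ℝ) ≤
      (mass f b - mass f a) / (T.card : ℝ) := by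
  classical
  rw [← integral_eq_mass_sub hf, ← intervalIntegral.integral_div]
  refine intervalIntegral.integral_mono_on_of_le_Ioo hab
    (integrable_share hf _ _).intervalIntegrable (hf.integrable.div_const _).intervalIntegrable ?_
  rintro y ⟨hay, hyb⟩
  have h2 : T.card ≤ congestion (halfWidths k) x y := by
    refine Finset.card_le_card fun j hj => ?_
    simpa [mem_attractionInterval_half] using hT y hay hyb j hj
  exact div_le_div_of_nonneg_left (hf.nonneg y) (by exact_mod_cast hT0.card_pos)
    (by exact_mod_cast h2)

theorem integral_share_add (hf : IsClientDensity f) {k : ℕ} (w x : Fin k → ℝ) (a b c : ℝ) :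
    (∫ y in a..b, f y / (congestion w x y : ℝ)) + ∫ y in b..c, f y / (congestion w x y : ℝ) =
      ∫ y in a..c, f y / (congestion w x y : ℝ) :=
  intervalIntegral.integral_add_adjacent_intervals (integrable_share hf _ _).intervalIntegrable
    (integrable_share hf _ _).intervalIntegrable

theorem support_sub_support (hf : IsClientDensity f) {k : ℕ} (x : Fin k → ℝ) (i j : Fin k) :
    support f (halfWidths k) x j - support f (halfWidths k) x i =
      (∫ y in (x i + 1 / 4)..(x j + 1 / 4), f y / (congestion (halfWidths k) x y : ℝ)) -
      ∫ y in (x i - 1 / 4)..(x j - 1 / 4), f y / (congestion (halfWidths k) x y : ℝ) := by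
  have h := integral_share_add hf (halfWidths k) x
  have h1 := h (x i - 1 / 4) (x j - 1 / 4) (x j + 1 / 4)
  have h2 := h (x i - 1 / 4) (x i + 1 / 4) (x j + 1 / 4)
  rw [support_halfWidths, support_halfWidths]
  linarith

theorem congestion_const (m : ℕ) (x y : ℝ) :
    congestion (halfWidths m) (fun _ => x) y = if x - 1 / 4 ≤ y ∧ y ≤ x + 1 / 4 then m else 0 := by
  classical
  simp only [congestion, mem_attractionInterval_half]
  split_ifs with h
  · rw [Finset.filter_true_of_mem fun _ _ => h, Finset.card_univ, Fintype.card_fin]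
  · rw [Finset.filter_false_of_mem fun _ _ => h, Finset.card_empty]

theorem newcomerSupport_of_le (hf : IsClientDensity f) (m : ℕ) {x z : ℝ}
    (hx : x ∈ locations (1 / 2)) (hz : z ∈ locations (1 / 2)) (h : z ≤ x) :
    newcomerSupport f (fun _ : Fin m => x) z =
      (mass f (x - 1 / 4) - mass f (z - 1 / 4)) +
        (mass f (z + 1 / 4) - mass f (x - 1 / 4)) / (m + 1) := by
  rw [mem_locations_half] at hx hz
  have hint := integrable_newcomer_share hf (halfWidths m) fun _ => x
  rw [newcomerSupport, ← intervalIntegral.integral_add_adjacent_intervals (b := x - 1 / 4)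
    hint.intervalIntegrable hint.intervalIntegrable, ← integral_eq_mass_sub hf,
    ← integral_eq_mass_sub hf, ← intervalIntegral.integral_div]
  congr 1
  · refine intervalIntegral.integral_congr_Ioo_of_le (by linarith) fun y hy => ?_
    simp only [congestion_const]
    rw [if_neg (by rintro ⟨h1, h2⟩; linarith [hy.2])]
    simp
  · refine intervalIntegral.integral_congr_Ioo_of_le (by linarith) fun y hy => ?_
    simp only [congestion_const]
    rw [if_pos ⟨hy.1.le, by linarith [hy.2]⟩]

theorem newcomerSupport_of_ge (hf : IsClientDensity f) (m : ℕ) {x z : ℝ}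
    (hx : x ∈ locations (1 / 2)) (hz : z ∈ locations (1 / 2)) (h : x ≤ z) :
    newcomerSupport f (fun _ : Fin m => x) z =
      (mass f (z + 1 / 4) - mass f (x + 1 / 4)) +
        (mass f (x + 1 / 4) - mass f (z - 1 / 4)) / (m + 1) := by
  rw [mem_locations_half] at hx hz
  have hint := integrable_newcomer_share hf (halfWidths m) fun _ => x
  rw [newcomerSupport, ← intervalIntegral.integral_add_adjacent_intervals (b := x + 1 / 4)
    hint.intervalIntegrable hint.intervalIntegrable, add_comm, ← integral_eq_mass_sub hf,
    ← integral_eq_mass_sub hf, ← intervalIntegral.integral_div]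
  congr 1
  · refine intervalIntegral.integral_congr_Ioo_of_le (by linarith) fun y hy => ?_
    simp only [congestion_const]
    rw [if_neg (by rintro ⟨h1, h2⟩; linarith [hy.1])]
    simp
  · refine intervalIntegral.integral_congr_Ioo_of_le (by linarith) fun y hy => ?_
    simp only [congestion_const]
    rw [if_pos ⟨by linarith [hy.1], hy.2.le⟩]

/-- The difference between the supports of two agents is the difference between the supports that
each would obtain without the other, when all the remaining agents are at the same place. -/
theorem support_sub_support_eq_newcomer (hf : IsClientDensity f) {k m : ℕ} (hk : k = m + 2)
    (p : Fin k → ℝ) {x : ℝ} {i j : Fin k} (hij : i ≠ j) (hp : ∀ l, l ≠ i → l ≠ j → p l = x) :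
    support f (halfWidths k) p i - support f (halfWidths k) p j =
      newcomerSupport f (fun _ : Fin m => x) (p i) -
        newcomerSupport f (fun _ : Fin m => x) (p j) := by
  classical
  have hc : ∀ y, congestion (halfWidths k) p y =
      congestion (halfWidths m) (fun _ : Fin m => x) y +
        (if p i - 1 / 4 ≤ y ∧ y ≤ p i + 1 / 4 then 1 else 0) +
        (if p j - 1 / 4 ≤ y ∧ y ≤ p j + 1 / 4 then 1 else 0) := by
    intro y
    have hj : j ∈ Finset.univ.erase i := by simp [hij.symm]
    have hcard : ((Finset.univ.erase i).erase j).card = m := by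
      rw [Finset.card_erase_of_mem hj, Finset.card_erase_of_mem (Finset.mem_univ _)]
      simp [hk]
    have hr : ∑ l ∈ (Finset.univ.erase i).erase j,
        (if p l - 1 / 4 ≤ y ∧ y ≤ p l + 1 / 4 then 1 else 0) =
        if x - 1 / 4 ≤ y ∧ y ≤ x + 1 / 4 then m else 0 := by
      rw [Finset.sum_congr rfl (g := fun _ => if x - 1 / 4 ≤ y ∧ y ≤ x + 1 / 4 then 1 else 0)]
      · split_ifs <;> simp [hcard]
      · intro l hl
        simp only [Finset.mem_erase] at hl
        rw [hp l hl.2.1 hl.1]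
    simp only [congestion, mem_attractionInterval_half] at *
    rw [Finset.card_filter, ← Finset.add_sum_erase _ _ (Finset.mem_univ i),
      ← Finset.add_sum_erase _ _ hj, hr]
    have := congestion_const m x y
    simp only [congestion, mem_attractionInterval_half] at this
    rw [this]
    ring
  have h1 := integrable_share hf (halfWidths k) p
  have h2 := integrable_newcomer_share hf (halfWidths m) fun _ => x
  have key : ∀ (φ : ℝ → ℝ) (z : ℝ), ∫ y in (z - 1 / 4)..(z + 1 / 4), φ y =
      ∫ y, (Icc (z - 1 / 4) (z + 1 / 4)).indicator φ y := by
    intro φ z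
    rw [intervalIntegral.integral_of_le (by linarith), ← integral_Icc_eq_integral_Ioc,
      integral_indicator measurableSet_Icc]
  rw [support_halfWidths, support_halfWidths, newcomerSupport, newcomerSupport, key, key, key, key,
    ← integral_sub (h1.indicator measurableSet_Icc) (h1.indicator measurableSet_Icc),
    ← integral_sub (h2.indicator measurableSet_Icc) (h2.indicator measurableSet_Icc)]
  congr 1
  funext y
  simp only [indicator_apply, mem_Icc, hc y]
  split_ifs <;> simp

theorem gain_nonpos_of_winners {k : ℕ} (w x : Fin k → ℝ) (i : Fin k) (z : ℝ)
    (hi : i ∈ winners f w x)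
    (h : ∀ j ∈ winners f w x,
      support f w (Function.update x i z) i ≤ support f w (Function.update x i z) j) :
    winnerUtility f w (Function.update x i z) i ≤ winnerUtility f w x i := by
  classical
  rw [winnerUtility, winnerUtility, if_pos hi]
  split_ifs with hw
  · have hsub : winners f w x ⊆ winners f w (Function.update x i z) := by
      intro j hj
      simp only [winners, Finset.mem_filter, Finset.mem_univ, true_and] at hw ⊢
      exact fun l => (hw l).trans (h j hj)
    exact one_div_le_one_div_of_le (by exact_mod_cast Finset.card_pos.2 ⟨i, hi⟩)
      (by exact_mod_cast Finset.card_le_card hsub)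
  · positivity

theorem gain_nonpos_of_lt {k : ℕ} (w x : Fin k → ℝ) (i j : Fin k) (z : ℝ)
    (h : support f w (Function.update x i z) i < support f w (Function.update x i z) j) :
    winnerUtility f w (Function.update x i z) i ≤ winnerUtility f w x i := by
  classical
  have h0 : i ∉ winners f w (Function.update x i z) := by
    simp only [winners, Finset.mem_filter, Finset.mem_univ, true_and, not_forall, not_le]
    exact ⟨j, h⟩
  rw [winnerUtility, winnerUtility, if_neg h0]
  split_ifs <;> positivity

theorem isCompact_locations (w : ℝ) : IsCompact (locations w) := isCompact_Icc

theorem quarter_mem_locations : (1 / 4 : ℝ) ∈ locations (1 / 2) :=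
  mem_locations_half.2 (by norm_num)

theorem three_quarters_mem_locations : (3 / 4 : ℝ) ∈ locations (1 / 2) :=
  mem_locations_half.2 (by norm_num)

theorem newcomerSupport_eq (hf : IsClientDensity f) (m : ℕ) {x z : ℝ}
    (hx : x ∈ locations (1 / 2)) (hz : z ∈ locations (1 / 2)) :
    newcomerSupport f (fun _ : Fin m => x) z =
      (mass f (z + 1 / 4) - mass f (z - 1 / 4)) -
        m / (m + 1) * (mass f (min x z + 1 / 4) - mass f (max x z - 1 / 4)) := by
  have hm : (m : ℝ) + 1 ≠ 0 := by positivity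
  rcases le_total z x with h | h
  · rw [newcomerSupport_of_le hf m hx hz h, min_eq_right h, max_eq_left h]
    field_simp
    ring
  · rw [newcomerSupport_of_ge hf m hx hz h, min_eq_left h, max_eq_right h]
    field_simp
    ring

theorem continuous_newcomerSupport_formula (hf : IsClientDensity f) (m : ℕ) :
    Continuous fun q : ℝ × ℝ => (mass f (q.2 + 1 / 4) - mass f (q.2 - 1 / 4)) -
      (m : ℝ) / (m + 1) * (mass f (min q.1 q.2 + 1 / 4) - mass f (max q.1 q.2 - 1 / 4)) := by
  have := continuous_mass hf
  fun_prop

theorem continuousOn_newcomerSupport (hf : IsClientDensity f) (m : ℕ) {x : ℝ}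
    (hx : x ∈ locations (1 / 2)) :
    ContinuousOn (newcomerSupport f (fun _ : Fin m => x)) (locations (1 / 2)) :=
  ((continuous_newcomerSupport_formula hf m).comp (Continuous.prodMk_right x)).continuousOn.congr
    fun _ hz => newcomerSupport_eq hf m hx hz

theorem exists_isLeftSolution (hf : IsClientDensity f) (m : ℕ) {x : ℝ}
    (hx : x ∈ locations (1 / 2)) :
    (∃ z, IsLeftSolution f m x z) ∧ ∀ z ∈ locations (1 / 2), z ≤ x →
      newcomerSupport f (fun _ : Fin m => x) z ≤ ll f m x := by
  obtain ⟨z, hz, h1, h2⟩ := ((isCompact_locations (1 / 2)).inter_right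
    (isClosed_Iic (a := x))).exists_sSup_image_eq_and_ge ⟨x, hx, self_mem_Iic⟩
    ((continuousOn_newcomerSupport hf m hx).mono inter_subset_left)
  exact ⟨⟨z, hz.1, hz.2, h1.symm⟩, fun y hy hyx => (h2 y ⟨hy, hyx⟩).trans_eq h1.symm⟩

theorem exists_isRightSolution (hf : IsClientDensity f) (m : ℕ) {x : ℝ}
    (hx : x ∈ locations (1 / 2)) :
    (∃ z, IsRightSolution f m x z) ∧ ∀ z ∈ locations (1 / 2), x ≤ z →
      newcomerSupport f (fun _ : Fin m => x) z ≤ rl f m x := by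
  obtain ⟨z, hz, h1, h2⟩ := ((isCompact_locations (1 / 2)).inter_right
    (isClosed_Ici (a := x))).exists_sSup_image_eq_and_ge ⟨x, hx, self_mem_Ici⟩
    ((continuousOn_newcomerSupport hf m hx).mono inter_subset_left)
  exact ⟨⟨z, hz.1, hz.2, h1.symm⟩, fun y hy hyx => (h2 y ⟨hy, hyx⟩).trans_eq h1.symm⟩

theorem continuousOn_ll (hf : IsClientDensity f) (m : ℕ) :
    ContinuousOn (ll f m) (locations (1 / 2)) := by
  have hc := (isCompact_locations (1 / 2)).continuous_sSup
    (f := fun x z => (mass f (min z x + 1 / 4) - mass f (min z x - 1 / 4)) -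
      (m : ℝ) / (m + 1) * (mass f (min x (min z x) + 1 / 4) - mass f (max x (min z x) - 1 / 4)))
    ((continuous_newcomerSupport_formula hf m).comp
      (continuous_fst.prodMk (continuous_snd.min continuous_fst)))
  refine hc.continuousOn.congr fun x hx => ?_
  have himg : {z ∈ locations (1 / 2) | z ≤ x} = (fun z => min z x) '' locations (1 / 2) := by
    ext z
    constructor
    · exact fun hz => ⟨z, hz.1, min_eq_left hz.2⟩
    · rintro ⟨y, hy, rfl⟩
      exact ⟨⟨le_min hy.1 hx.1, (min_le_left _ _).trans hy.2⟩, min_le_right _ _⟩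
  rw [ll, himg, image_image]
  refine congrArg sSup (image_congr fun z hz => ?_)
  exact newcomerSupport_eq hf m hx ⟨le_min hz.1 hx.1, (min_le_left _ _).trans hz.2⟩

theorem continuousOn_rl (hf : IsClientDensity f) (m : ℕ) :
    ContinuousOn (rl f m) (locations (1 / 2)) := by
  have hc := (isCompact_locations (1 / 2)).continuous_sSup
    (f := fun x z => (mass f (max z x + 1 / 4) - mass f (max z x - 1 / 4)) -
      (m : ℝ) / (m + 1) * (mass f (min x (max z x) + 1 / 4) - mass f (max x (max z x) - 1 / 4)))
    ((continuous_newcomerSupport_formula hf m).comp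
      (continuous_fst.prodMk (continuous_snd.max continuous_fst)))
  refine hc.continuousOn.congr fun x hx => ?_
  have himg : {z ∈ locations (1 / 2) | x ≤ z} = (fun z => max z x) '' locations (1 / 2) := by
    ext z
    constructor
    · exact fun hz => ⟨z, hz.1, max_eq_left hz.2⟩
    · rintro ⟨y, hy, rfl⟩
      exact ⟨⟨hy.1.trans (le_max_left _ _), max_le hy.2 hx.2⟩, le_max_right _ _⟩
  rw [rl, himg, image_image]
  refine congrArg sSup (image_congr fun z hz => ?_)
  exact newcomerSupport_eq hf m hx ⟨hz.1.trans (le_max_left _ _), max_le hz.2 hx.2⟩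

theorem exists_isBalancePoint (hf : IsClientDensity f) (m : ℕ) : ∃ x, IsBalancePoint f m x := by
  have h1 : ll f m (1 / 4) ≤ rl f m (1 / 4) := by
    obtain ⟨z, hz, hz', h⟩ := (exists_isLeftSolution hf m quarter_mem_locations).1
    rw [← h]
    exact (exists_isRightSolution hf m quarter_mem_locations).2 z hz (mem_locations_half.1 hz).1
  have h2 : rl f m (3 / 4) ≤ ll f m (3 / 4) := by
    obtain ⟨z, hz, hz', h⟩ := (exists_isRightSolution hf m three_quarters_mem_locations).1
    rw [← h]
    exact (exists_isLeftSolution hf m three_quarters_mem_locations).2 z hz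
      (mem_locations_half.1 hz).2
  obtain ⟨x, hx, h⟩ := (isPreconnected_Icc : IsPreconnected (locations (1 / 2))).intermediate_value₂
    quarter_mem_locations three_quarters_mem_locations (continuousOn_ll hf m)
    (continuousOn_rl hf m) h1 h2
  exact ⟨x, hx, h⟩

theorem exists_isFirstLocation (hf : IsClientDensity f) :
    (∃ x, IsFirstLocation f x) ∧ ∀ z ∈ locations (1 / 2),
      mass f (z + 1 / 4) - mass f (z - 1 / 4) ≤ maxSupport f := by
  have hc : Continuous fun z : ℝ => mass f (z + 1 / 4) - mass f (z - 1 / 4) := by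
    have := continuous_mass hf
    fun_prop
  simp only [IsFirstLocation, maxSupport, integral_eq_mass_sub hf]
  obtain ⟨z, hz, h1, h2⟩ := (isCompact_locations (1 / 2)).exists_sSup_image_eq_and_ge
    ⟨_, quarter_mem_locations⟩ hc.continuousOn
  exact ⟨⟨z, hz, h1.symm⟩, fun y hy => (h2 y hy).trans_eq h1.symm⟩

theorem nextMaximizesAt_iff (hf : IsClientDensity f) {x : ℝ} (hx : x ∈ locations (1 / 2)) (m : ℕ) :
    NextMaximizesAt f x m ↔ ∀ z ∈ locations (1 / 2),
      (z ≤ x → (m + 1 : ℝ) * (mass f (x - 1 / 4) - mass f (z - 1 / 4)) ≤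
        mass f (x + 1 / 4) - mass f (z + 1 / 4)) ∧
      (x ≤ z → (m + 1 : ℝ) * (mass f (z + 1 / 4) - mass f (x + 1 / 4)) ≤
        mass f (z - 1 / 4) - mass f (x - 1 / 4)) := by
  have hm : (0 : ℝ) < m + 1 := by positivity
  refine forall₂_congr fun z hz => ?_
  have hxx := newcomerSupport_of_le hf m hx hx le_rfl
  have hl : z ≤ x → (newcomerSupport f (fun _ : Fin m => x) z ≤
      newcomerSupport f (fun _ : Fin m => x) x ↔
      (m + 1 : ℝ) * (mass f (x - 1 / 4) - mass f (z - 1 / 4)) ≤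
        mass f (x + 1 / 4) - mass f (z + 1 / 4)) := by
    intro h
    rw [hxx, newcomerSupport_of_le hf m hx hz h, sub_self, zero_add, le_div_iff₀ hm, add_mul,
      div_mul_cancel₀ _ hm.ne']
    constructor <;> intro h <;> linarith
  have hr : x ≤ z → (newcomerSupport f (fun _ : Fin m => x) z ≤
      newcomerSupport f (fun _ : Fin m => x) x ↔
      (m + 1 : ℝ) * (mass f (z + 1 / 4) - mass f (x + 1 / 4)) ≤
        mass f (z - 1 / 4) - mass f (x - 1 / 4)) := by
    intro h
    rw [hxx, newcomerSupport_of_ge hf m hx hz h, sub_self, zero_add, le_div_iff₀ hm, add_mul,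
      div_mul_cancel₀ _ hm.ne']
    constructor <;> intro h <;> linarith
  constructor
  · exact fun h => ⟨fun hzx => (hl hzx).1 h, fun hxz => (hr hxz).1 h⟩
  · rintro ⟨h1, h2⟩
    rcases le_total z x with h | h
    · exact (hl h).2 (h1 h)
    · exact (hr h).2 (h2 h)

theorem NextMaximizesAt.anti (hf : IsClientDensity f) {x : ℝ} (hx : x ∈ locations (1 / 2))
    {j m : ℕ} (hjm : j ≤ m) (h : NextMaximizesAt f x m) : NextMaximizesAt f x j := by
  rw [nextMaximizesAt_iff hf hx] at h ⊢
  have hjm' : (j : ℝ) + 1 ≤ m + 1 := by exact_mod_cast Nat.succ_le_succ hjm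
  refine fun z hz => ⟨fun hzx => ?_, fun hxz => ?_⟩
  · refine le_trans (mul_le_mul_of_nonneg_right hjm' ?_) ((h z hz).1 hzx)
    exact sub_nonneg.2 (mass_mono hf (by linarith))
  · refine le_trans (mul_le_mul_of_nonneg_right hjm' ?_) ((h z hz).2 hxz)
    exact sub_nonneg.2 (mass_mono hf (by linarith))

theorem IsFirstLocation.nextMaximizesAt_zero (hf : IsClientDensity f) {x₁ : ℝ}
    (h₁ : IsFirstLocation f x₁) : NextMaximizesAt f x₁ 0 := by
  rw [nextMaximizesAt_iff hf h₁.1]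
  intro z hz
  have h := (exists_isFirstLocation hf).2 z hz
  rw [← h₁.2, integral_eq_mass_sub hf] at h
  constructor <;> intro _ <;> push_cast <;> linarith

/-- If some location is the best one for a newcomer as soon as `m ≥ 1` agents occupy it, then so is
every location of maximal support. -/
theorem IsFirstLocation.nextMaximizesAt (hf : IsClientDensity f) {x x₁ : ℝ} {m : ℕ} (hm : 1 ≤ m)
    (hx : x ∈ locations (1 / 2)) (h : NextMaximizesAt f x m) (h₁ : IsFirstLocation f x₁) :
    NextMaximizesAt f x₁ m := by
  have hmax := (exists_isFirstLocation hf).2 x hx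
  rw [← h₁.2, integral_eq_mass_sub hf] at hmax
  rw [nextMaximizesAt_iff hf hx] at h
  have hm' : (1 : ℝ) ≤ m := by exact_mod_cast hm
  have hH : mass f (x₁ - 1 / 4) = mass f (x - 1 / 4) ∧
      mass f (x₁ + 1 / 4) = mass f (x + 1 / 4) := by
    rcases le_total x₁ x with hle | hle
    · have h1 := (h x₁ h₁.1).1 hle
      have h2 : mass f (x₁ - 1 / 4) ≤ mass f (x - 1 / 4) := mass_mono hf (by linarith)
      have h3 : mass f (x₁ + 1 / 4) ≤ mass f (x + 1 / 4) := mass_mono hf (by linarith)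
      have h4 := mul_le_mul_of_nonneg_right hm' (sub_nonneg.2 h2)
      constructor <;> linarith
    · have h1 := (h x₁ h₁.1).2 hle
      have h2 : mass f (x - 1 / 4) ≤ mass f (x₁ - 1 / 4) := mass_mono hf (by linarith)
      have h3 : mass f (x + 1 / 4) ≤ mass f (x₁ + 1 / 4) := mass_mono hf (by linarith)
      have h4 := mul_le_mul_of_nonneg_right hm' (sub_nonneg.2 h3)
      constructor <;> linarith
  rw [nextMaximizesAt_iff hf h₁.1]
  intro z hz
  rw [hH.1, hH.2]
  refine ⟨fun hzx => ?_, fun hxz => ?_⟩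
  · rcases le_total z x with hle | hle
    · exact (h z hz).1 hle
    · have h2 : mass f (x - 1 / 4) ≤ mass f (z - 1 / 4) := mass_mono hf (by linarith)
      have h3 : mass f (z + 1 / 4) ≤ mass f (x₁ + 1 / 4) := mass_mono hf (by linarith)
      have h4 : (0 : ℝ) ≤ (m + 1) * (mass f (z - 1 / 4) - mass f (x - 1 / 4)) :=
        mul_nonneg (by positivity) (sub_nonneg.2 h2)
      linarith
  · rcases le_total x z with hle | hle
    · exact (h z hz).2 hle
    · have h2 : mass f (x₁ - 1 / 4) ≤ mass f (z - 1 / 4) := mass_mono hf (by linarith)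
      have h3 : mass f (z + 1 / 4) ≤ mass f (x + 1 / 4) := mass_mono hf (by linarith)
      have h4 : (0 : ℝ) ≤ (m + 1) * (mass f (x + 1 / 4) - mass f (z + 1 / 4)) :=
        mul_nonneg (by positivity) (sub_nonneg.2 h3)
      linarith

theorem nextMaximizesAt_of_lt_stackSize {x₁ : ℝ} {j : ℕ} (h : (j : ℕ∞) < stackSize f x₁) :
    NextMaximizesAt f x₁ j := by
  obtain ⟨t, ht, hj⟩ := lt_sSup_iff.1 h
  exact ht j hj

theorem exists_not_nextMaximizesAt {x₁ : ℝ} {k : ℕ} (ht : stackSize f x₁ + 2 ≤ (k : ℕ∞)) :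
    ∃ j, j + 2 ≤ k ∧ ¬ NextMaximizesAt f x₁ j := by
  by_contra! hall
  have hk : 2 ≤ k := by
    have : (2 : ℕ∞) ≤ k := le_trans le_add_self ht
    exact_mod_cast this
  have h1 : ((k - 1 : ℕ) : ℕ∞) ≤ stackSize f x₁ := by
    refine le_sSup fun j hj => hall j ?_
    have : j < k - 1 := by exact_mod_cast hj
    omega
  have h2 : ((k - 1 : ℕ) : ℕ∞) + 2 ≤ k := le_trans (by gcongr) ht
  have h3 : k - 1 + 2 ≤ k := by exact_mod_cast h2
  omega

/-- At a balance point the outer locations are strictly better than the balance point itself. -/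
theorem IsBalancePoint.newcomerSupport_lt (hf : IsClientDensity f) {x x₁ : ℝ} {m : ℕ} (hm : 1 ≤ m)
    (hx : IsBalancePoint f m x) (h₁ : IsFirstLocation f x₁) (hn : ¬ NextMaximizesAt f x₁ m) :
    newcomerSupport f (fun _ : Fin m => x) x < ll f m x := by
  by_contra! h
  refine hn (h₁.nextMaximizesAt hf hm hx.1 fun z hz => ?_)
  rcases le_total z x with hle | hle
  · exact ((exists_isLeftSolution hf m hx.1).2 z hz hle).trans h
  · exact ((exists_isRightSolution hf m hx.1).2 z hz hle).trans (hx.2 ▸ h)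

/-- An agent that is at or moves to the left of the bulk stays behind the right outer agent. -/
theorem support_lt_support_right (hf : IsClientDensity f) {k m : ℕ} (hk : k = m + 2) (hm : 1 ≤ m)
    {p : Fin k → ℝ} {x v : ℝ} {i l r : Fin k} (hil : i ≠ l) (hir : i ≠ r) (hlr : l ≠ r)
    (hp : ∀ j, j ≠ i → j ≠ l → j ≠ r → p j = x) (hx : x ∈ locations (1 / 2))
    (hloc : ∀ j, p j ∈ locations (1 / 2)) (hi : p i ≤ x) (hl : p l ≤ x) (hr : x ≤ p r)
    (hgi : newcomerSupport f (fun _ : Fin m => x) (p i) ≤ v)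
    (hgl : newcomerSupport f (fun _ : Fin m => x) (p l) = v)
    (hgr : newcomerSupport f (fun _ : Fin m => x) (p r) = v)
    (hgx : newcomerSupport f (fun _ : Fin m => x) x < v) :
    support f (halfWidths k) p i < support f (halfWidths k) p r := by
  classical
  have hm0 : (0 : ℝ) < m := by exact_mod_cast hm
  obtain ⟨q, hq⟩ : ∃ q, q = max (p i) (p l) := ⟨_, rfl⟩
  have hqi : p i ≤ q := hq ▸ le_max_left _ _
  have hql : p l ≤ q := hq ▸ le_max_right _ _
  have hqx : q ≤ x := hq ▸ max_le hi hl
  have bd := fun j => mem_locations_half.1 (hloc j)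
  have bx := mem_locations_half.1 hx
  have c1 : ((Finset.univ.erase i).card : ℝ) = m + 1 := by
    rw [Finset.card_erase_of_mem (Finset.mem_univ _)]; simp [hk]
  have c2 : (((Finset.univ.erase i).erase l).card : ℝ) = m := by
    rw [Finset.card_erase_of_mem (by simp [hil.symm]),
      Finset.card_erase_of_mem (Finset.mem_univ _)]; simp [hk]
  have c3 : ((Finset.univ.erase r).card : ℝ) = m + 1 := by
    rw [Finset.card_erase_of_mem (Finset.mem_univ _)]; simp [hk]
  have c4 : (({i, l} : Finset (Fin k)).card : ℝ) = 2 := by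
    rw [Finset.card_pair hil]; norm_num
  have A1 := le_integral_share hf p (a := p i + 1 / 4) (b := q + 1 / 4) (by linarith)
    (Finset.univ.erase i) r
    (fun y h1 h2 => ⟨by linarith [(bd r).2, (bd i).1], by linarith⟩)
    (fun y h1 h2 j hj => by
      obtain rfl : j = i := by simpa using hj
      exact fun h => by linarith [h.2])
  have A2 := le_integral_share hf p (a := q + 1 / 4) (b := x + 1 / 4) (by linarith)
    ((Finset.univ.erase i).erase l) r
    (fun y h1 h2 => ⟨by linarith [(bd r).2, (bd i).1], by linarith⟩)
    (fun y h1 h2 j hj h => by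
      by_cases hji : j = i
      · subst hji; linarith [h.2]
      · obtain rfl : j = l := by
          by_contra hjl
          exact hj (by simp [hji, hjl])
        linarith [h.2])
  have A3 := le_integral_share hf p (a := x + 1 / 4) (b := p r + 1 / 4) (by linarith) {r} r
    (fun y h1 h2 => ⟨by linarith [(bd r).2, (bd i).1], by linarith⟩)
    (fun y h1 h2 j hj h => by
      have hjr : j ≠ r := by simpa using hj
      have : p j ≤ x := by
        by_cases hji : j = i
        · rwa [hji]
        by_cases hjl : j = l
        · rwa [hjl]
        exact (hp j hji hjl hjr).le
      linarith [h.2])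
  have B1 := integral_share_le hf p (a := p i - 1 / 4) (b := q - 1 / 4) (by linarith) {i}
    (Finset.singleton_nonempty _)
    (fun y h1 h2 j hj => by
      obtain rfl : j = i := by simpa using hj
      exact ⟨by linarith, by linarith [(bd j).1]⟩)
  have B2 := integral_share_le hf p (a := q - 1 / 4) (b := x - 1 / 4) (by linarith) {i, l}
    (Finset.insert_nonempty _ _)
    (fun y h1 h2 j hj => by
      have hj' : j = i ∨ j = l := by simpa using hj
      have := (bd j).1
      rcases hj' with rfl | rfl <;> constructor <;> linarith)
  have B3 := integral_share_le hf p (a := x - 1 / 4) (b := p r - 1 / 4) (by linarith)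
    (Finset.univ.erase r) ⟨i, by simp [hir]⟩
    (fun y h1 h2 j hj => by
      have hjr : j ≠ r := by simpa using hj
      have : p j ≤ x := by
        by_cases hji : j = i
        · rwa [hji]
        by_cases hjl : j = l
        · rwa [hjl]
        exact (hp j hji hjl hjr).le
      exact ⟨by linarith, by linarith [(bd j).1, (bd r).2]⟩)
  have hd := support_sub_support hf p i r
  rw [← integral_share_add hf _ _ _ (q + 1 / 4) (p r + 1 / 4),
    ← integral_share_add hf _ _ _ (x + 1 / 4) (p r + 1 / 4),
    ← integral_share_add hf _ _ _ (q - 1 / 4) (p r - 1 / 4),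
    ← integral_share_add hf _ _ _ (x - 1 / 4) (p r - 1 / 4)] at hd
  rw [c1] at A1
  rw [c2] at A2
  rw [c3] at B3
  rw [c4] at B2
  rw [Finset.card_singleton, Nat.cast_one, div_one] at A3 B1
  have hqg : q = p i ∨ q = p l := hq ▸ max_choice _ _
  have hqloc : q ∈ locations (1 / 2) := by rcases hqg with h | h <;> rw [h] <;> exact hloc _
  have gi := newcomerSupport_of_le hf m hx (hloc i) hi
  have gq := newcomerSupport_of_le hf m hx hqloc hqx
  have gx := newcomerSupport_of_le hf m hx hx le_rfl
  have gr := newcomerSupport_of_ge hf m hx (hloc r) hr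
  have mK : mass f (q + 1 / 4) ≤ mass f (x + 1 / 4) := mass_mono hf (by linarith)
  have mH : mass f (q - 1 / 4) ≤ mass f (x - 1 / 4) := mass_mono hf (by linarith)
  have hsplit : (mass f (x + 1 / 4) - mass f (q + 1 / 4)) / (m : ℝ) =
      (mass f (x + 1 / 4) - mass f (q + 1 / 4)) / ((m : ℝ) + 1) +
      (mass f (x + 1 / 4) - mass f (q + 1 / 4)) / ((m : ℝ) * (m + 1)) := by
    field_simp
  have hK : 0 ≤ (mass f (x + 1 / 4) - mass f (q + 1 / 4)) / ((m : ℝ) * (m + 1)) :=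
    div_nonneg (sub_nonneg.2 mK) (by positivity)
  rw [hsplit] at A2
  simp only [sub_div] at *
  by_contra! hcon
  have e1 : newcomerSupport f (fun _ : Fin m => x) (p i) = v := by linarith
  have e2 : mass f (x - 1 / 4) = mass f (q - 1 / 4) := by linarith
  have e3 : mass f (x + 1 / 4) / ((m : ℝ) * (m + 1)) = mass f (q + 1 / 4) / ((m : ℝ) * (m + 1)) := by
    linarith
  rw [div_left_inj' (by positivity)] at e3
  have e4 : newcomerSupport f (fun _ : Fin m => x) q = v := by
    rcases hqg with h | h <;> rw [h] <;> assumption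
  rw [gq, ← e2, ← e3, ← gx] at e4
  exact hgx.ne e4

/-- An agent that is at or moves to the right of the bulk stays behind the left outer agent. -/
theorem support_lt_support_left (hf : IsClientDensity f) {k m : ℕ} (hk : k = m + 2) (hm : 1 ≤ m)
    {p : Fin k → ℝ} {x v : ℝ} {i l r : Fin k} (hil : i ≠ l) (hir : i ≠ r) (hlr : l ≠ r)
    (hp : ∀ j, j ≠ i → j ≠ l → j ≠ r → p j = x) (hx : x ∈ locations (1 / 2))
    (hloc : ∀ j, p j ∈ locations (1 / 2)) (hi : x ≤ p i) (hl : p l ≤ x) (hr : x ≤ p r)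
    (hgi : newcomerSupport f (fun _ : Fin m => x) (p i) ≤ v)
    (hgl : newcomerSupport f (fun _ : Fin m => x) (p l) = v)
    (hgr : newcomerSupport f (fun _ : Fin m => x) (p r) = v)
    (hgx : newcomerSupport f (fun _ : Fin m => x) x < v) :
    support f (halfWidths k) p i < support f (halfWidths k) p l := by
  classical
  have hm0 : (0 : ℝ) < m := by exact_mod_cast hm
  obtain ⟨q, hq⟩ : ∃ q, q = min (p i) (p r) := ⟨_, rfl⟩
  have hqi : q ≤ p i := hq ▸ min_le_left _ _
  have hqr : q ≤ p r := hq ▸ min_le_right _ _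
  have hqx : x ≤ q := hq ▸ le_min hi hr
  have bd := fun j => mem_locations_half.1 (hloc j)
  have bx := mem_locations_half.1 hx
  have c1 : ((Finset.univ.erase i).card : ℝ) = m + 1 := by
    rw [Finset.card_erase_of_mem (Finset.mem_univ _)]; simp [hk]
  have c2 : (((Finset.univ.erase i).erase r).card : ℝ) = m := by
    rw [Finset.card_erase_of_mem (by simp [hir.symm]),
      Finset.card_erase_of_mem (Finset.mem_univ _)]; simp [hk]
  have c3 : ((Finset.univ.erase l).card : ℝ) = m + 1 := by
    rw [Finset.card_erase_of_mem (Finset.mem_univ _)]; simp [hk]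
  have c4 : (({i, r} : Finset (Fin k)).card : ℝ) = 2 := by
    rw [Finset.card_pair hir]; norm_num
  have A1 := le_integral_share hf p (a := q - 1 / 4) (b := p i - 1 / 4) (by linarith)
    (Finset.univ.erase i) l
    (fun y h1 h2 => ⟨by linarith, by linarith [(bd l).1, (bd i).2]⟩)
    (fun y h1 h2 j hj => by
      obtain rfl : j = i := by simpa using hj
      exact fun h => by linarith [h.1])
  have A2 := le_integral_share hf p (a := x - 1 / 4) (b := q - 1 / 4) (by linarith)
    ((Finset.univ.erase i).erase r) l
    (fun y h1 h2 => ⟨by linarith, by linarith [(bd l).1, (bd i).2]⟩)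
    (fun y h1 h2 j hj h => by
      by_cases hji : j = i
      · subst hji; linarith [h.1]
      · obtain rfl : j = r := by
          by_contra hjl
          exact hj (by simp [hji, hjl])
        linarith [h.1])
  have A3 := le_integral_share hf p (a := p l - 1 / 4) (b := x - 1 / 4) (by linarith) {l} l
    (fun y h1 h2 => ⟨by linarith, by linarith [(bd l).1, (bd i).2]⟩)
    (fun y h1 h2 j hj h => by
      have hjl : j ≠ l := by simpa using hj
      have : x ≤ p j := by
        by_cases hji : j = i
        · rwa [hji]
        by_cases hjr : j = r
        · rwa [hjr]
        exact (hp j hji hjl hjr).ge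
      linarith [h.1])
  have B1 := integral_share_le hf p (a := q + 1 / 4) (b := p i + 1 / 4) (by linarith) {i}
    (Finset.singleton_nonempty _)
    (fun y h1 h2 j hj => by
      obtain rfl : j = i := by simpa using hj
      exact ⟨by linarith [(bd j).2], by linarith⟩)
  have B2 := integral_share_le hf p (a := x + 1 / 4) (b := q + 1 / 4) (by linarith) {i, r}
    (Finset.insert_nonempty _ _)
    (fun y h1 h2 j hj => by
      have hj' : j = i ∨ j = r := by simpa using hj
      have := (bd j).2
      rcases hj' with rfl | rfl <;> constructor <;> linarith)
  have B3 := integral_share_le hf p (a := p l + 1 / 4) (b := x + 1 / 4) (by linarith)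
    (Finset.univ.erase l) ⟨i, by simp [hil]⟩
    (fun y h1 h2 j hj => by
      have hjl : j ≠ l := by simpa using hj
      have : x ≤ p j := by
        by_cases hji : j = i
        · rwa [hji]
        by_cases hjr : j = r
        · rwa [hjr]
        exact (hp j hji hjl hjr).ge
      exact ⟨by linarith [(bd j).2, (bd l).1], by linarith⟩)
  have hd := support_sub_support hf p l i
  rw [← integral_share_add hf _ _ _ (q + 1 / 4) (p i + 1 / 4),
    ← integral_share_add hf _ _ _ (x + 1 / 4) (q + 1 / 4),
    ← integral_share_add hf _ _ _ (q - 1 / 4) (p i - 1 / 4),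
    ← integral_share_add hf _ _ _ (x - 1 / 4) (q - 1 / 4)] at hd
  rw [c1] at A1
  rw [c2] at A2
  rw [c3] at B3
  rw [c4] at B2
  rw [Finset.card_singleton, Nat.cast_one, div_one] at A3 B1
  have hqg : q = p i ∨ q = p r := hq ▸ min_choice _ _
  have hqloc : q ∈ locations (1 / 2) := by rcases hqg with h | h <;> rw [h] <;> exact hloc _
  have gi := newcomerSupport_of_ge hf m hx (hloc i) hi
  have gq := newcomerSupport_of_ge hf m hx hqloc hqx
  have gx := newcomerSupport_of_ge hf m hx hx le_rfl
  have gl := newcomerSupport_of_le hf m hx (hloc l) hl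
  have mK : mass f (x + 1 / 4) ≤ mass f (q + 1 / 4) := mass_mono hf (by linarith)
  have mH : mass f (x - 1 / 4) ≤ mass f (q - 1 / 4) := mass_mono hf (by linarith)
  have hsplit : (mass f (q - 1 / 4) - mass f (x - 1 / 4)) / (m : ℝ) =
      (mass f (q - 1 / 4) - mass f (x - 1 / 4)) / ((m : ℝ) + 1) +
      (mass f (q - 1 / 4) - mass f (x - 1 / 4)) / ((m : ℝ) * (m + 1)) := by
    field_simp
  have hH : 0 ≤ (mass f (q - 1 / 4) - mass f (x - 1 / 4)) / ((m : ℝ) * (m + 1)) :=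
    div_nonneg (sub_nonneg.2 mH) (by positivity)
  rw [hsplit] at A2
  simp only [sub_div] at *
  by_contra! hcon
  have e1 : newcomerSupport f (fun _ : Fin m => x) (p i) = v := by linarith
  have e2 : mass f (x + 1 / 4) = mass f (q + 1 / 4) := by linarith
  have e3 : mass f (x - 1 / 4) / ((m : ℝ) * (m + 1)) = mass f (q - 1 / 4) / ((m : ℝ) * (m + 1)) := by
    linarith
  rw [div_left_inj' (by positivity)] at e3
  have e4 : newcomerSupport f (fun _ : Fin m => x) q = v := by
    rcases hqg with h | h <;> rw [h] <;> assumption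
  rw [gq, ← e2, ← e3, ← gx] at e4
  exact hgx.ne e4

theorem support_congr {n : ℕ} {w x : Fin n → ℝ} {i j : Fin n} (hw : w i = w j) (hx : x i = x j) :
    support f w x i = support f w x j := by
  rw [support, support, hw, hx]

theorem update_mem_locations {k : ℕ} {p : Fin k → ℝ} (hp : ∀ j, p j ∈ locations (1 / 2))
    (i : Fin k) {z : ℝ} (hz : z ∈ locations (1 / 2)) (j : Fin k) :
    Function.update p i z j ∈ locations (1 / 2) := by
  rcases eq_or_ne j i with rfl | h
  · simpa using hz
  · simpa [h] using hp j

theorem isWinnerNashEquilibrium_stack (hf : IsClientDensity f) {k : ℕ} {x₁ : ℝ}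
    (h₁ : IsFirstLocation f x₁) (ht : (k : ℕ∞) ≤ stackSize f x₁ + 1) :
    IsWinnerNashEquilibrium f (halfWidths k) fun _ => x₁ := by
  refine ⟨fun _ => h₁.1, fun i z hz => gain_nonpos_of_winners _ _ i z ?_ fun j _ => ?_⟩
  · simp only [winners, Finset.mem_filter, Finset.mem_univ, true_and]
    exact fun j => (support_congr rfl rfl).le
  rcases eq_or_ne i j with rfl | hij
  · exact le_rfl
  obtain ⟨m, rfl⟩ : ∃ m, k = m + 2 := by
    refine ⟨k - 2, ?_⟩
    have := i.2
    have := j.2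
    have : (i : ℕ) ≠ j := fun h => hij (Fin.ext h)
    omega
  have hm : (m : ℕ∞) < stackSize f x₁ := by
    have h : ((m + 1 : ℕ) : ℕ∞) + 1 ≤ stackSize f x₁ + 1 := by exact_mod_cast ht
    have h' : ((m + 1 : ℕ) : ℕ∞) ≤ stackSize f x₁ := by
      rcases eq_or_ne (stackSize f x₁) ⊤ with h0 | h0
      · simp [h0]
      · exact (ENat.add_le_add_iff_right ENat.one_ne_top).1 h
    exact ENat.natCast_add_one_le_iff.1 (by exact_mod_cast h')
  have hd := support_sub_support_eq_newcomer hf rfl (Function.update (fun _ : Fin (m + 2) => x₁) i z)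
    (x := x₁) hij (fun l hl _ => by simp [hl])
  have hn := nextMaximizesAt_of_lt_stackSize hm z hz
  simp only [Function.update_self, Function.update_of_ne hij.symm] at hd
  linarith

theorem isWinnerNashEquilibrium_outer (hf : IsClientDensity f) {k m : ℕ} (hk : k = m + 2)
    (hm : 1 ≤ m) {p : Fin k → ℝ} {x v : ℝ} {l r : Fin k} (hlr : l ≠ r)
    (hp : ∀ j, j ≠ l → j ≠ r → p j = x) (hx : x ∈ locations (1 / 2))
    (hloc : ∀ j, p j ∈ locations (1 / 2)) (hl : p l ≤ x) (hr : x ≤ p r)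
    (hg : ∀ z ∈ locations (1 / 2), newcomerSupport f (fun _ : Fin m => x) z ≤ v)
    (hgl : newcomerSupport f (fun _ : Fin m => x) (p l) = v)
    (hgr : newcomerSupport f (fun _ : Fin m => x) (p r) = v)
    (hgx : newcomerSupport f (fun _ : Fin m => x) x < v) :
    IsWinnerNashEquilibrium f (halfWidths k) p := by
  have heq : support f (halfWidths k) p l = support f (halfWidths k) p r := by
    have := support_sub_support_eq_newcomer hf hk p hlr hp
    linarith
  have hlt : ∀ j, j ≠ l → j ≠ r →
      support f (halfWidths k) p j < support f (halfWidths k) p r := by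
    intro j hjl hjr
    have hj := hp j hjl hjr
    exact support_lt_support_right hf hk hm hjl hjr hlr (fun s _ => hp s) hx hloc hj.le hl hr
      (hg _ (hloc j)) hgl hgr hgx
  have hle : ∀ j, support f (halfWidths k) p j ≤ support f (halfWidths k) p r := by
    intro j
    by_cases hjl : j = l
    · rw [hjl, heq]
    by_cases hjr : j = r
    · rw [hjr]
    exact (hlt j hjl hjr).le
  have hwr : r ∈ winners f (halfWidths k) p := by
    simpa only [winners, Finset.mem_filter, Finset.mem_univ, true_and] using hle
  have hwl : l ∈ winners f (halfWidths k) p := by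
    simpa only [winners, Finset.mem_filter, Finset.mem_univ, true_and, heq] using hle
  have hw : ∀ j ∈ winners f (halfWidths k) p, j = l ∨ j = r := by
    intro j hj
    by_contra! h
    simp only [winners, Finset.mem_filter, Finset.mem_univ, true_and] at hj
    exact absurd (hlt j h.1 h.2) (not_lt.2 (hj r))
  refine ⟨hloc, fun i z hz => ?_⟩
  have hz' : z ∈ locations (1 / 2) := hz
  by_cases hil : i = l
  · subst hil
    refine gain_nonpos_of_winners _ _ _ _ hwl fun j hj => ?_
    rcases hw j hj with rfl | rfl
    · exact le_rfl
    have hd := support_sub_support_eq_newcomer hf hk (Function.update p i z) hlr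
      (fun s h1 h2 => by rw [Function.update_of_ne h1]; exact hp s h1 h2)
    rw [Function.update_self, Function.update_of_ne hlr.symm] at hd
    linarith [hg z hz']
  by_cases hir : i = r
  · subst hir
    refine gain_nonpos_of_winners _ _ _ _ hwr fun j hj => ?_
    rcases hw j hj with rfl | rfl
    swap
    · exact le_rfl
    have hd := support_sub_support_eq_newcomer hf hk (Function.update p i z) hlr
      (fun s h1 h2 => by rw [Function.update_of_ne h2]; exact hp s h1 h2)
    rw [Function.update_self, Function.update_of_ne hlr] at hd
    linarith [hg z hz']
  have hli : l ≠ i := Ne.symm hil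
  have hri : r ≠ i := Ne.symm hir
  have hp' : ∀ j, j ≠ i → j ≠ l → j ≠ r → Function.update p i z j = x := by
    intro j h1 h2 h3
    rw [Function.update_of_ne h1]
    exact hp j h2 h3
  have hloc' := update_mem_locations hloc i hz'
  have ei : Function.update p i z i = z := Function.update_self ..
  have el : Function.update p i z l = p l := Function.update_of_ne hli ..
  have er : Function.update p i z r = p r := Function.update_of_ne hri ..
  rcases le_total z x with hzx | hzx
  · exact gain_nonpos_of_lt _ _ i r z (support_lt_support_right hf hk hm hil hir hlr hp' hx hloc'
      (by rwa [ei]) (by rwa [el]) (by rwa [er]) (by rw [ei]; exact hg z hz') (by rwa [el])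
      (by rwa [er]) hgx)
  · exact gain_nonpos_of_lt _ _ i l z (support_lt_support_left hf hk hm hil hir hlr hp' hx hloc'
      (by rwa [ei]) (by rwa [el]) (by rwa [er]) (by rw [ei]; exact hg z hz') (by rwa [el])
      (by rwa [er]) hgx)

theorem isWinnerNashEquilibrium_balanced (hf : IsClientDensity f) {k : ℕ} {x₁ xs xl xr : ℝ}
    (h₁ : IsFirstLocation f x₁) (ht : stackSize f x₁ + 2 ≤ (k : ℕ∞))
    (hs : IsBalancePoint f (k - 2) xs) (hl : IsLeftSolution f (k - 2) xs xl)
    (hr : IsRightSolution f (k - 2) xs xr) :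
    IsWinnerNashEquilibrium f (halfWidths k) (balancedProfile k xs xl xr) := by
  obtain ⟨j, hj, hnj⟩ := exists_not_nextMaximizesAt ht
  have hj0 : j ≠ 0 := by
    rintro rfl
    exact hnj (h₁.nextMaximizesAt_zero hf)
  obtain ⟨m, rfl⟩ : ∃ m, k = m + 2 := ⟨k - 2, by omega⟩
  rw [Nat.add_sub_cancel] at hs hl hr
  have hm : 1 ≤ m := by omega
  have hn : ¬ NextMaximizesAt f x₁ m := fun h => hnj (h.anti hf h₁.1 (by omega))
  have el : balancedProfile (m + 2) xs xl xr ⟨m, by omega⟩ = xl := by simp [balancedProfile]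
  have er : balancedProfile (m + 2) xs xl xr ⟨m + 1, by omega⟩ = xr := by simp [balancedProfile]
  refine isWinnerNashEquilibrium_outer hf rfl hm (l := ⟨m, by omega⟩) (r := ⟨m + 1, by omega⟩)
    (x := xs) (v := ll f m xs) (by simp) (fun i h1 h2 => ?_) hs.1 (fun i => ?_)
    (by rw [el]; exact hl.2.1)
    (by rw [er]; exact hr.2.1) (fun z hz => ?_) (by rw [el]; exact hl.2.2)
    (by rw [er, hs.2]; exact hr.2.2) (hs.newcomerSupport_lt hf hm h₁ hn)
  · have := i.2
    have h1' : (i : ℕ) ≠ m := fun h => h1 (Fin.ext h)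
    have h2' : (i : ℕ) ≠ m + 1 := fun h => h2 (Fin.ext h)
    rw [balancedProfile, if_pos (by omega)]
  · rw [balancedProfile]
    split_ifs
    exacts [hs.1, hl.1, hr.1]
  · rcases le_total z xs with h | h
    · exact (exists_isLeftSolution hf m hs.1).2 z hz h
    · rw [hs.2]
      exact (exists_isRightSolution hf m hs.1).2 z hz h

/-! ### The split profile -/

/-- Two agents `l` and `r` of support `u₁` have disjoint attraction intervals up to null sets. -/
theorem mass_half_of_supports_eq (hf : IsClientDensity f) {x : Fin 2 → ℝ}
    (hx : ∀ i, x i ∈ locations (1 / 2))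
    (h : ∀ i, support f (halfWidths 2) x i = maxSupport f) {l r : Fin 2} (hne : l ≠ r)
    (hlr : x l ≤ x r) :
    mass f (1 / 2) = maxSupport f ∧ mass f 1 - mass f (1 / 2) = maxSupport f := by
  have bd := fun j => mem_locations_half.1 (hx j)
  have hall : ∀ j, j = l ∨ j = r := by
    intro j
    rcases eq_or_ne j l with h' | h'
    · exact Or.inl h'
    · right; revert hne h'; fin_cases j <;> fin_cases l <;> fin_cases r <;> simp
  have hS := (exists_isFirstLocation hf).2
  have c4 : (({l, r} : Finset (Fin 2)).card : ℝ) = 2 := by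
    rw [Finset.card_pair hne]; norm_num
  have B1 := integral_share_le hf x (a := x l - 1 / 4) (b := x r - 1 / 4) (by linarith) {l}
    (Finset.singleton_nonempty _)
    (fun y h1 h2 j hj => by
      obtain rfl : j = l := by simpa using hj
      exact ⟨by linarith, by linarith [(bd j).1, (bd r).2]⟩)
  have B2 := integral_share_le hf x (a := x r - 1 / 4) (b := x l + 1 / 4)
    (by linarith [(bd l).1, (bd r).2]) {l, r} (Finset.insert_nonempty _ _)
    (fun y h1 h2 j _ => by rcases hall j with rfl | rfl <;> constructor <;> linarith)
  have B3 := integral_share_le hf x (a := x l + 1 / 4) (b := x r + 1 / 4) (by linarith) {r}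
    (Finset.singleton_nonempty _)
    (fun y h1 h2 j hj => by
      obtain rfl : j = r := by simpa using hj
      exact ⟨by linarith [(bd j).2, (bd l).1], by linarith⟩)
  rw [c4] at B2
  rw [Finset.card_singleton, Nat.cast_one, div_one] at B1 B3
  have sl := h l
  have sr := h r
  rw [support_halfWidths, ← integral_share_add hf _ _ _ (x r - 1 / 4)] at sl
  rw [support_halfWidths, ← integral_share_add hf _ _ _ (x l + 1 / 4)] at sr
  have q1 := hS _ quarter_mem_locations
  have q2 := hS _ three_quarters_mem_locations
  norm_num [mass_zero] at q1 q2
  have hSl := hS _ (hx l)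
  have hSr := hS _ (hx r)
  have m1 : mass f (x r - 1 / 4) ≤ mass f (1 / 2) := mass_mono hf (by linarith [(bd r).2])
  have m2 : mass f (1 / 2) ≤ mass f (x l + 1 / 4) := mass_mono hf (by linarith [(bd l).1])
  have m3 : mass f 0 ≤ mass f (x l - 1 / 4) := mass_mono hf (by linarith [(bd l).1])
  have m4 : mass f (x r + 1 / 4) ≤ mass f 1 := mass_mono hf (by linarith [(bd r).2])
  rw [mass_zero] at m3
  constructor <;> linarith

/-- An agent at `3 / 4` compared with a deviating agent `i`. -/
theorem le_support_three_quarters_sub (hf : IsClientDensity f) {k : ℕ} {p : Fin k → ℝ}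
    {A : Finset (Fin k)} {i j : Fin k} (hij : j ≠ i) (hj : j ∉ A)
    (hi : p i ∈ locations (1 / 2)) (hA : ∀ l ∈ A, l ≠ i → p l = 1 / 4)
    (hB : ∀ l ∉ A, l ≠ i → p l = 3 / 4) :
    (mass f 1 - mass f (p i + 1 / 4)) / ((Aᶜ.erase i).card : ℝ) -
        (mass f (1 / 2) - mass f (p i - 1 / 4)) / ((A.erase i).card + 1 : ℝ) ≤
      support f (halfWidths k) p j - support f (halfWidths k) p i := by
  have bi := mem_locations_half.1 hi
  have pj := hB j hj hij
  have L := le_integral_share hf p (a := p i + 1 / 4) (b := 1) (by linarith) (Aᶜ.erase i) j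
    (fun y h1 h2 => by rw [pj]; constructor <;> linarith)
    (fun y h1 h2 l hl h => by
      by_cases hli : l = i
      · subst hli; linarith [h.2]
      have hlA : l ∈ A := by
        by_contra hlA
        exact hl (by simp [hli, hlA])
      rw [hA l hlA hli] at h
      linarith [h.2])
  have U := integral_share_le hf p (a := p i - 1 / 4) (b := 1 / 2) (by linarith)
    (insert i (A.erase i)) (Finset.insert_nonempty _ _)
    (fun y h1 h2 l hl => by
      by_cases hli : l = i
      · subst hli; constructor <;> linarith
      have hlA : l ∈ A := by simpa [hli] using hl
      rw [hA l hlA hli]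
      constructor <;> linarith)
  rw [Finset.card_insert_of_notMem (Finset.notMem_erase _ _)] at U
  have hd := support_sub_support hf p i j
  rw [pj] at hd
  norm_num at hd U L ⊢
  linarith

/-- An agent at `1 / 4` compared with a deviating agent `i`. -/
theorem le_support_quarter_sub (hf : IsClientDensity f) {k : ℕ} {p : Fin k → ℝ}
    {A : Finset (Fin k)} {i j : Fin k} (hij : j ≠ i) (hj : j ∈ A)
    (hi : p i ∈ locations (1 / 2)) (hA : ∀ l ∈ A, l ≠ i → p l = 1 / 4)
    (hB : ∀ l ∉ A, l ≠ i → p l = 3 / 4) :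
    (mass f (p i - 1 / 4) - mass f 0) / ((A.erase i).card : ℝ) -
        (mass f (p i + 1 / 4) - mass f (1 / 2)) / ((Aᶜ.erase i).card + 1 : ℝ) ≤
      support f (halfWidths k) p j - support f (halfWidths k) p i := by
  have bi := mem_locations_half.1 hi
  have pj := hA j hj hij
  have L := le_integral_share hf p (a := 0) (b := p i - 1 / 4) (by linarith) (A.erase i) j
    (fun y h1 h2 => by rw [pj]; constructor <;> linarith)
    (fun y h1 h2 l hl h => by
      by_cases hli : l = i
      · subst hli; linarith [h.1]
      have hlA : l ∉ A := fun hlA => hl (by simp [hli, hlA])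
      rw [hB l hlA hli] at h
      linarith [h.1])
  have U := integral_share_le hf p (a := 1 / 2) (b := p i + 1 / 4) (by linarith)
    (insert i (Aᶜ.erase i)) (Finset.insert_nonempty _ _)
    (fun y h1 h2 l hl => by
      by_cases hli : l = i
      · subst hli; constructor <;> linarith
      have hlA : l ∉ A := by simpa [hli] using hl
      rw [hB l hlA hli]
      constructor <;> linarith)
  rw [Finset.card_insert_of_notMem (Finset.notMem_erase _ _)] at U
  have hd := support_sub_support hf p j i
  rw [pj] at hd
  norm_num at hd U L ⊢
  linarith

theorem twoAgentsAchieveMax_iff (hf : IsClientDensity f) :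
    TwoAgentsAchieveMax f ↔ (∫ y in (0 : ℝ)..(1 / 2), f y) = maxSupport f ∧
      (∫ y in (1 / 2 : ℝ)..1, f y) = maxSupport f := by
  rw [integral_eq_mass_sub hf, integral_eq_mass_sub hf, mass_zero, sub_zero]
  constructor
  · rintro ⟨x, hx, h⟩
    rcases le_total (x 0) (x 1) with hle | hle
    · exact mass_half_of_supports_eq hf hx h (by decide) hle
    · exact mass_half_of_supports_eq hf hx h (by decide) hle
  · rintro ⟨h1, h2⟩
    have hloc : ∀ i, (![1 / 4, 3 / 4] : Fin 2 → ℝ) i ∈ locations (1 / 2) := by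
      intro i
      fin_cases i
      exacts [quarter_mem_locations, three_quarters_mem_locations]
    refine ⟨![1 / 4, 3 / 4], hloc, fun i => ?_⟩
    have key : ∀ i : Fin 2, ∀ a b : ℝ, a ≤ b → (![1 / 4, 3 / 4] : Fin 2 → ℝ) i - 1 / 4 = a →
        (![1 / 4, 3 / 4] : Fin 2 → ℝ) i + 1 / 4 = b →
        (∀ y, a < y → y < b → ∀ j, j ≠ i → ¬ ((![1 / 4, 3 / 4] : Fin 2 → ℝ) j - 1 / 4 ≤ y ∧
          y ≤ (![1 / 4, 3 / 4] : Fin 2 → ℝ) j + 1 / 4)) →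
        support f (halfWidths 2) ![1 / 4, 3 / 4] i = mass f b - mass f a := by
      intro i a b hab ha hb hT
      rw [support_halfWidths, ha, hb]
      have L := le_integral_share hf ![1 / 4, 3 / 4] hab {i} i
        (fun y h1 h2 => by rw [ha, hb]; exact ⟨h1.le, h2.le⟩)
        (fun y h1 h2 j hj => hT y h1 h2 j (by simpa using hj))
      have U := integral_share_le hf ![1 / 4, 3 / 4] hab {i} (Finset.singleton_nonempty _)
        (fun y h1 h2 j hj => by
          obtain rfl : j = i := by simpa using hj
          rw [ha, hb]; exact ⟨h1.le, h2.le⟩)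
      rw [Finset.card_singleton, Nat.cast_one, div_one] at L U
      exact le_antisymm U L
    fin_cases i
    · refine (key 0 0 (1 / 2) (by norm_num) (by norm_num) (by norm_num) ?_).trans
        (by rw [mass_zero, sub_zero, h1])
      intro y hy1 hy2 j hj
      obtain rfl : j = 1 := by omega
      rintro ⟨h, -⟩
      norm_num at h
      linarith
    · refine (key 1 (1 / 2) 1 (by norm_num) (by norm_num) (by norm_num) ?_).trans h2
      intro y hy1 hy2 j hj
      obtain rfl : j = 0 := by omega
      rintro ⟨-, h⟩
      norm_num at h
      linarith

theorem isWinnerNashEquilibrium_split (hf : IsClientDensity f) (k : ℕ)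
    (h : TwoAgentsAchieveMax f) :
    IsWinnerNashEquilibrium f (halfWidths k) (splitProfile k) := by
  rw [twoAgentsAchieveMax_iff hf, integral_eq_mass_sub hf, integral_eq_mass_sub hf, mass_zero,
    sub_zero, mass_one hf] at h
  have hhalf : mass f (1 / 2) = 1 / 2 := by linarith
  have hS := (exists_isFirstLocation hf).2
  rw [← h.1, hhalf] at hS
  obtain ⟨A, hAdef⟩ : ∃ A : Finset (Fin k),
    A = Finset.univ.filter fun l : Fin k => (l : ℕ) < (k + 1) / 2 := ⟨_, rfl⟩
  have pA : ∀ l ∈ A, splitProfile k l = 1 / 4 := by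
    intro l hl
    rw [hAdef, Finset.mem_filter] at hl
    rw [splitProfile, if_pos hl.2]
  have pB : ∀ l ∉ A, splitProfile k l = 3 / 4 := by
    intro l hl
    rw [splitProfile, if_neg fun h => hl (by simp [hAdef, h])]
  have cA : A.card = (k + 1) / 2 := by
    rw [hAdef, Fin.card_filter_val_lt]
    omega
  have cB : Aᶜ.card = k - (k + 1) / 2 := by
    rw [Finset.card_compl, cA, Fintype.card_fin]
  have hloc : ∀ l, splitProfile k l ∈ locations (1 / 2) := by
    intro l
    by_cases hl : l ∈ A
    · rw [pA l hl]; exact quarter_mem_locations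
    · rw [pB l hl]; exact three_quarters_mem_locations
  have cmem : ∀ i ∈ A, (A.erase i).card = (k + 1) / 2 - 1 ∧
      (Aᶜ.erase i).card = k - (k + 1) / 2 := by
    intro i hi
    rw [Finset.card_erase_of_mem hi, Finset.erase_eq_of_notMem (by simpa using hi), cA, cB]
    exact ⟨rfl, rfl⟩
  have cnot : ∀ i ∉ A, (A.erase i).card = (k + 1) / 2 ∧
      (Aᶜ.erase i).card = k - (k + 1) / 2 - 1 := by
    intro i hi
    rw [Finset.erase_eq_of_notMem hi, Finset.card_erase_of_mem (by simpa using hi), cA, cB]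
    exact ⟨rfl, rfl⟩
  -- comparison of the supports in the split profile
  have base : ∀ i ∈ A, ∀ j ∉ A, (1 / 2) / ((k - (k + 1) / 2 : ℕ) : ℝ) -
      (1 / 2) / (((k + 1) / 2 : ℕ) : ℝ) =
      support f (halfWidths k) (splitProfile k) j - support f (halfWidths k) (splitProfile k) i := by
    intro i hi j hj
    have hij : j ≠ i := fun h => hj (h ▸ hi)
    have h1 := le_support_three_quarters_sub hf hij hj (hloc i) (fun l hl _ => pA l hl)
      (fun l hl _ => pB l hl)
    have h2 := le_support_quarter_sub hf hij.symm hi (hloc j) (fun l hl _ => pA l hl)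
      (fun l hl _ => pB l hl)
    have e1 : (((A.erase i).card : ℕ) : ℝ) + 1 = A.card := by
      exact_mod_cast Finset.card_erase_add_one hi
    have e2 : (((Aᶜ.erase j).card : ℕ) : ℝ) + 1 = Aᶜ.card := by
      exact_mod_cast Finset.card_erase_add_one (by simpa using hj)
    rw [e1, (cmem i hi).2, cA, pA i hi] at h1
    rw [e2, (cnot j hj).1, cB, pB j hj] at h2
    norm_num [mass_zero, mass_one hf, hhalf] at h1 h2 ⊢
    linarith
  have same : ∀ i j, (i ∈ A ↔ j ∈ A) → support f (halfWidths k) (splitProfile k) i =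
      support f (halfWidths k) (splitProfile k) j := by
    intro i j hij
    refine support_congr rfl ?_
    by_cases hi : i ∈ A
    · rw [pA i hi, pA j (hij.1 hi)]
    · rw [pB i hi, pB j fun h => hi (hij.2 h)]
  refine ⟨hloc, fun i z hz => ?_⟩
  have hz' : z ∈ locations (1 / 2) := hz
  have bz := mem_locations_half.1 hz'
  have hP : mass f (z - 1 / 4) ≤ 1 / 2 := hhalf ▸ mass_mono hf (by linarith)
  have hQ : 1 / 2 ≤ mass f (z + 1 / 4) := hhalf ▸ mass_mono hf (by linarith)
  have hP0 : 0 ≤ mass f (z - 1 / 4) := by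
    rw [← mass_zero (f := f)]; exact mass_mono hf (by linarith)
  have hQ1 : mass f (z + 1 / 4) ≤ 1 :=
    (mass_mono hf (by linarith)).trans_eq (mass_one hf)
  have hSz := hS z hz'
  have devL : ∀ j ∈ A, j ≠ i → mass f (z - 1 / 4) / ((A.erase i).card : ℝ) -
      (mass f (z + 1 / 4) - 1 / 2) / ((Aᶜ.erase i).card + 1 : ℝ) ≤
      support f (halfWidths k) (Function.update (splitProfile k) i z) j -
        support f (halfWidths k) (Function.update (splitProfile k) i z) i := by
    intro j hj hji
    have := le_support_quarter_sub hf hji hj (p := Function.update (splitProfile k) i z)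
      (by simpa using hz') (fun l hl hli => by rw [Function.update_of_ne hli]; exact pA l hl)
      (fun l hl hli => by rw [Function.update_of_ne hli]; exact pB l hl)
    rwa [Function.update_self, mass_zero, sub_zero, hhalf] at this
  have devR : ∀ j ∉ A, j ≠ i → (1 - mass f (z + 1 / 4)) / ((Aᶜ.erase i).card : ℝ) -
      (1 / 2 - mass f (z - 1 / 4)) / ((A.erase i).card + 1 : ℝ) ≤
      support f (halfWidths k) (Function.update (splitProfile k) i z) j -
        support f (halfWidths k) (Function.update (splitProfile k) i z) i := by
    intro j hj hji
    have := le_support_three_quarters_sub hf hji hj (p := Function.update (splitProfile k) i z)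
      (by simpa using hz') (fun l hl hli => by rw [Function.update_of_ne hli]; exact pA l hl)
      (fun l hl hli => by rw [Function.update_of_ne hli]; exact pB l hl)
    rwa [Function.update_self, mass_one hf, hhalf] at this
  have weakL : (A.erase i).card ≤ (Aᶜ.erase i).card + 1 → ∀ j ∈ A,
      support f (halfWidths k) (Function.update (splitProfile k) i z) i ≤
        support f (halfWidths k) (Function.update (splitProfile k) i z) j := by
    intro hc j hj
    rcases eq_or_ne j i with rfl | hji
    · exact le_rfl
    have hpos : 0 < (A.erase i).card := Finset.card_pos.2 ⟨j, by simp [hj, hji]⟩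
    have := div_le_div₀ (a := mass f (z + 1 / 4) - 1 / 2) (c := mass f (z - 1 / 4))
      (d := (A.erase i).card) (b := (Aᶜ.erase i).card + 1) hP0
      (by linarith) (Nat.cast_pos.2 hpos) (by exact_mod_cast hc)
    linarith [devL j hj hji]
  have weakR : (Aᶜ.erase i).card ≤ (A.erase i).card + 1 → ∀ j ∉ A,
      support f (halfWidths k) (Function.update (splitProfile k) i z) i ≤
        support f (halfWidths k) (Function.update (splitProfile k) i z) j := by
    intro hc j hj
    rcases eq_or_ne j i with rfl | hji
    · exact le_rfl
    have hpos : 0 < (Aᶜ.erase i).card := Finset.card_pos.2 ⟨j, by simp [hj, hji]⟩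
    have := div_le_div₀ (a := 1 / 2 - mass f (z - 1 / 4)) (c := 1 - mass f (z + 1 / 4))
      (d := (Aᶜ.erase i).card) (b := (A.erase i).card + 1)
      (by linarith) (by linarith) (Nat.cast_pos.2 hpos) (by exact_mod_cast hc)
    linarith [devR j hj hji]
  have hik : 0 < k := i.pos
  by_cases heven : k = 2 * ((k + 1) / 2)
  · have hall : ∀ a b, support f (halfWidths k) (splitProfile k) a =
        support f (halfWidths k) (splitProfile k) b := by
      have e : k - (k + 1) / 2 = (k + 1) / 2 := by omega
      rw [e, sub_self] at base
      intro a b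
      by_cases ha : a ∈ A <;> by_cases hb : b ∈ A
      · exact same a b (by simp [ha, hb])
      · linarith [base a ha b hb]
      · linarith [base b hb a ha]
      · exact same a b (by simp [ha, hb])
    refine gain_nonpos_of_winners _ _ i z ?_ fun j _ => ?_
    · simp only [winners, Finset.mem_filter, Finset.mem_univ, true_and]
      exact fun j => (hall j i).le
    have hc : (A.erase i).card ≤ (Aᶜ.erase i).card + 1 ∧
        (Aᶜ.erase i).card ≤ (A.erase i).card + 1 := by
      by_cases hi : i ∈ A
      · rw [(cmem i hi).1, (cmem i hi).2]; omega
      · rw [(cnot i hi).1, (cnot i hi).2]; omega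
    by_cases hj : j ∈ A
    · exact weakL hc.1 j hj
    · exact weakR hc.2 j hj
  rcases Nat.eq_or_lt_of_le (Nat.succ_le_of_lt hik) with hk1 | hk1
  · have : Subsingleton (Fin k) := by rw [← hk1]; infer_instance
    refine gain_nonpos_of_winners _ _ i z ?_ fun j _ => by rw [Subsingleton.elim i j]
    simp only [winners, Finset.mem_filter, Finset.mem_univ, true_and]
    exact fun j => by rw [Subsingleton.elim i j]
  obtain ⟨n, hn⟩ : ∃ n, k = 2 * n + 1 := ⟨(k - 1) / 2, by omega⟩
  have hn1 : 1 ≤ n := by omega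
  have e1 : (k + 1) / 2 = n + 1 := by omega
  have e2 : k - (k + 1) / 2 = n := by omega
  rw [e1] at cA
  rw [e2] at cB
  have hn0 : (0 : ℝ) < n := by exact_mod_cast hn1
  by_cases hi : i ∈ A
  · obtain ⟨j₁, hj₁⟩ : (A.erase i).Nonempty := Finset.card_pos.1 (by rw [(cmem i hi).1]; omega)
    obtain ⟨j₂, hj₂⟩ : Aᶜ.Nonempty := Finset.card_pos.1 (by omega)
    rw [Finset.mem_erase] at hj₁
    rw [Finset.mem_compl] at hj₂
    have d1 := devL j₁ hj₁.2 hj₁.1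
    have d2 := devR j₂ hj₂ fun h => hj₂ (h ▸ hi)
    rw [(cmem i hi).1, (cmem i hi).2, e2, e1, Nat.add_sub_cancel] at d1 d2
    have : 0 < mass f (z - 1 / 4) / (n : ℝ) - (mass f (z + 1 / 4) - 1 / 2) / (n + 1 : ℝ) ∨
        0 < (1 - mass f (z + 1 / 4)) / (n : ℝ) - (1 / 2 - mass f (z - 1 / 4)) / (n + 1 : ℝ) := by
      by_contra! hcon
      obtain ⟨h1, h2⟩ := hcon
      rw [sub_nonpos, div_le_div_iff₀ hn0 (by positivity)] at h1 h2
      have h3 := mul_nonneg hn0.le (show 0 ≤ mass f (z - 1 / 4) - (mass f (z + 1 / 4) - 1 / 2) by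
        linarith)
      linarith
    rcases this with h | h
    · exact gain_nonpos_of_lt _ _ i j₁ z (by linarith)
    · exact gain_nonpos_of_lt _ _ i j₂ z (by linarith)
  · have hlt : (1 / 2 : ℝ) / ((n + 1 : ℕ) : ℝ) < (1 / 2) / (n : ℝ) := by
      apply div_lt_div_of_pos_left (by norm_num) hn0
      exact_mod_cast Nat.lt_succ_self n
    rw [e2, e1] at base
    refine gain_nonpos_of_winners _ _ i z ?_ fun j hj => ?_
    · simp only [winners, Finset.mem_filter, Finset.mem_univ, true_and]
      intro j
      by_cases hj : j ∈ A
      · linarith [base j hj i hi]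
      · exact (same j i (by simp [hi, hj])).le
    · have hjA : j ∉ A := by
        intro hjA
        simp only [winners, Finset.mem_filter, Finset.mem_univ, true_and] at hj
        linarith [base j hjA i hi, hj i]
      refine weakR ?_ j hjA
      rw [(cnot i hi).1, (cnot i hi).2]
      omega

theorem exists_algorithm2 (hf : IsClientDensity f) (k : ℕ) : ∃ p, Algorithm2 f k p := by
  by_cases h : TwoAgentsAchieveMax f
  · exact ⟨_, .split h⟩
  obtain ⟨x₁, h₁⟩ := (exists_isFirstLocation hf).1
  rcases le_or_gt (k : ℕ∞) (stackSize f x₁ + 1) with ht | ht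
  · exact ⟨_, .stack x₁ h h₁ ht⟩
  · obtain ⟨xs, hs⟩ := exists_isBalancePoint hf (k - 2)
    obtain ⟨xl, hl⟩ := (exists_isLeftSolution hf (k - 2) hs.1).1
    obtain ⟨xr, hr⟩ := (exists_isRightSolution hf (k - 2) hs.1).1
    refine ⟨_, .balance x₁ xs xl xr h h₁ ?_ hs hl hr⟩
    have := Order.add_one_le_of_lt ht
    rwa [add_assoc, one_add_one_eq_two] at this

end AttractionGame

theorem mainTheorem6 (f : ℝ → ℝ) (hf : AttractionGame.IsClientDensity f) (k : ℕ) :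
    -- the first location exists, and the case distinction is the explicit one
    (∃ x₁, AttractionGame.IsFirstLocation f x₁) ∧
    (AttractionGame.TwoAgentsAchieveMax f ↔
      (∫ y in (0 : ℝ)..(1 / 2), f y) = AttractionGame.maxSupport f ∧
      (∫ y in (1 / 2 : ℝ)..1, f y) = AttractionGame.maxSupport f) ∧
    -- in the last case the balance point and the two outer locations exist
    (∀ x₁, ¬ AttractionGame.TwoAgentsAchieveMax f → AttractionGame.IsFirstLocation f x₁ →
      AttractionGame.stackSize f x₁ + 2 ≤ (k : ℕ∞) →
        (∃ xs, AttractionGame.IsBalancePoint f (k - 2) xs) ∧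
        ∀ xs, AttractionGame.IsBalancePoint f (k - 2) xs →
          (∃ xl, AttractionGame.IsLeftSolution f (k - 2) xs xl) ∧
          ∃ xr, AttractionGame.IsRightSolution f (k - 2) xs xr) ∧
    -- the algorithm has an output, and every output is a Nash equilibrium
    (∃ p : Fin k → ℝ, AttractionGame.Algorithm2 f k p) ∧
    ∀ p : Fin k → ℝ, AttractionGame.Algorithm2 f k p →
      AttractionGame.IsWinnerNashEquilibrium f (AttractionGame.halfWidths k) p := by
  refine ⟨(AttractionGame.exists_isFirstLocation hf).1, AttractionGame.twoAgentsAchieveMax_iff hf,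
    fun _ _ _ _ => ⟨AttractionGame.exists_isBalancePoint hf _, fun xs hs =>
      ⟨(AttractionGame.exists_isLeftSolution hf _ hs.1).1,
        (AttractionGame.exists_isRightSolution hf _ hs.1).1⟩⟩,
    AttractionGame.exists_algorithm2 hf k, ?_⟩
  rintro p (h | ⟨x₁, _, h₁, ht⟩ | ⟨x₁, xs, xl, xr, _, h₁, ht, hs, hl, hr⟩)
  · exact AttractionGame.isWinnerNashEquilibrium_split hf k h
  · exact AttractionGame.isWinnerNashEquilibrium_stack hf h₁ ht
  · exact AttractionGame.isWinnerNashEquilibrium_balanced hf h₁ ht hs hl hr
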